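/- **Setting.** Let $\mathcal{L}$ be a first-order language expanding the language of groups. Let $\mathcal{L}^+$ be the two-sorted language obtained from $\mathcal{L}$ by adding a sort $\mathcal{I}$ with a binary relation $<$ and a binary function $d$ on it and, for every $\mathcal{L}$-formula $\theta(\bar x;\bar y)$, a function symbol $\mu_\theta(\bar y)$ from the home sort to $\mathcal{I}$. A finite $\mathcal{L}$-structure $A$ is canonically an $\mathcal{L}^+$-structure: $\mathcal{I}$ is $[0,1]$ with its usual order and distance, and $\mu_\theta(\bar b)=|\theta(A^{\bar x};\bar b)|/|A|^{|\bar x|}$. Let $(A_i)_{i\in I}$ be finite $\mathcal{L}$-structures expanding groups, let $\mathcal{U}$ be an ultrafilter on $I$, and let $G$ be (the home sort of) an $\mathcal{L}^+$-elementary extension of $\prod_{\mathcal U}A_i$. The pseudofinite counting measure is defined by $\mu(\theta(\bar x;\bar b))=\operatorname{st}(\mu_\theta(\bar b))\in[0,1]$, the standard part of $\mu_\theta(\bar b)$. Formulas are $\mathcal{L}$-formulas with parameters from $G$. For a formula $\phi(x)$ in one variable of the home sort, put $\phi^{\ell}(x;y)=\phi(y\cdot x)$, $\phi^{r}(x;y)=\phi(x\cdot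 y)$, and for $\epsilon\ge 0$ $$\operatorname{Stab}^{\epsilon}_\mu(\phi)=\{g\in G:\mu(\phi(g^{-1}x)\,\triangle\,\phi(x))\le\epsilon\},\qquad \operatorname{Stab}_\mu(\phi)=\operatorname{Stab}^{0}_\mu(\phi).$$ A formula $\delta(x;y)$ is *NIP* if for some $k\ge1$ there are no $(a_i)_{i\in[k]}$ and $(b_X)_{X\subseteq[k]}$ in $G$ such that $\delta(a_i;b_X)$ holds if and only if $i\in X$. A set $X\subseteq G$ is *left generic* if finitely many left translates of $X$ cover $G$. It is *$\delta$-type-definable over* $B\subseteq G$ if it is an intersection of sets each of which is defined by a finite Boolean combination of formulas $\delta(x;b)$ with $b\in B$. **Statement.** Let $\phi(x)$ be a formula such that $\phi^{\ell}(x;y)$ is NIP. Then: 1. For every real $\epsilon>0$, $\operatorname{Stab}^{\epsilon}_\mu(\phi)$ is left generic, and it is $\phi^{r}$-type-definable over a countable subset of $G$. 2. $\operatorname{Stab}_\mu(\phi)$ is a subgroup of $G$ of index at most $2^{\aleph_0}$ (so of bounded index, i.e. of index less than $\kappa$, if $G$ is $\kappa$-saturated with $\kappa>2^{\aleph_0}$),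 and it is $\phi^{r}$-type-definable over a countable subset of $G$. -/

import Mathlib

open FirstOrder FirstOrder.Language

open scoped Pointwise Cardinal

universe u v

noncomputable section

namespace PseudofiniteGroup

/-! ### Languages expanding the language of groups -/

/-- `L` expands the language of groups. -/
class GroupLanguage (L : FirstOrder.Language.{u, v}) where
  mulSym : L.Functions 2
  oneSym : L.Functions 0
  invSym : L.Functions 1

/-- The group symbols of `L` are interpreted in `G` by its group operations. -/
class CompatibleGroup (L : FirstOrder.Language.{u, v}) [GroupLanguage L] (G : Type*) [L.Structure G]
    [Group G] : Prop where
  funMap_mul : ∀ x : Fin 2 → G,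
    Structure.funMap (GroupLanguage.mulSym : L.Functions 2) x = x 0 * x 1
  funMap_one : ∀ x : Fin 0 → G, Structure.funMap (GroupLanguage.oneSym : L.Functions 0) x = 1
  funMap_inv : ∀ x : Fin 1 → G,
    Structure.funMap (GroupLanguage.invSym : L.Functions 1) x = (x 0)⁻¹

/-! ### The two-sorted language `L⁺`

`L⁺` adds to `L` a sort `I` with a binary relation `<`, a binary function `d`, and, for each
`L`-formula `φ(x₁,…,x_m; y₁,…,y_n)`, an `n`-ary function symbol `μ_φ` from the home sort to `I`.
A two-sorted structure with home sort `G` and second sort `J` is coded as a one-sorted structure on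
the disjoint union `G ⊕ J`, with a predicate `home` for the home sort. -/

/-- The function symbols of `L⁺`. -/
inductive PlusFunctions (L : FirstOrder.Language.{u, v}) : ℕ → Type (max u v)
  | base {n : ℕ} (f : L.Functions n) : PlusFunctions L n
  | dist : PlusFunctions L 2
  | mu {m n : ℕ} (φ : L.Formula (Fin m ⊕ Fin n)) : PlusFunctions L n

/-- The relation symbols of `L⁺`. -/
inductive PlusRelations (L : FirstOrder.Language.{u, v}) : ℕ → Type v
  | base {n : ℕ} (R : L.Relations n) : PlusRelations L n
  | home : PlusRelations L 1
  | lt : PlusRelations L 2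

/-- The language `L⁺`. -/
def plus (L : FirstOrder.Language.{u, v}) : FirstOrder.Language.{max u v, v} :=
  ⟨PlusFunctions L, PlusRelations L⟩

/-- An expansion of the `L`-structure `G` to a two-sorted `L⁺`-structure with second sort `J`:
interpretations of the new symbols. -/
class SecondSort (L : FirstOrder.Language.{u, v}) (G : Type*) [L.Structure G] (J : Type*) where
  lt : J → J → Prop
  dist : J → J → J
  mu : ∀ {m n : ℕ}, L.Formula (Fin m ⊕ Fin n) → (Fin n → G) → J

open Classical in
/-- Extend an operation `f` from tuples of the sort `i : α → M` to all tuples of `M`; a tuple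
that is not of this sort (so has positive length) is sent to its first entry. -/
def extendSort {α M : Type*} {n : ℕ} (i : α → M) (f : (Fin n → α) → M) (x : Fin n → M) : M :=
  if h : ∃ a : Fin n → α, x = i ∘ a then f h.choose
  else x ⟨0, Nat.pos_of_ne_zero (by
    rintro rfl
    exact h ⟨Fin.elim0, Subsingleton.elim _ _⟩)⟩

/-- The one-sorted coding on `G ⊕ J` of a two-sorted `L⁺`-structure. -/
instance plusStructure (L : FirstOrder.Language.{u, v}) (G : Type*) [L.Structure G] (J : Type*)
    [SecondSort L G J] : (plus L).Structure (G ⊕ J) where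
  funMap := fun {_} F => match F with
    | PlusFunctions.base f =>
        extendSort Sum.inl (fun a : _ → G => Sum.inl (Structure.funMap f a))
    | PlusFunctions.dist =>
        extendSort Sum.inr (fun a : _ → J => Sum.inr (SecondSort.dist L G (a 0) (a 1)))
    | PlusFunctions.mu φ =>
        extendSort Sum.inl (fun a : _ → G => Sum.inr (SecondSort.mu φ a))
  RelMap := fun {_} R => match R with
    | PlusRelations.base R => fun x => ∃ a : _ → G, x = Sum.inl ∘ a ∧ Structure.RelMap R a
    | PlusRelations.home => fun x => ∃ g : G, x 0 = Sum.inl g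
    | PlusRelations.lt => fun x =>
        ∃ a : _ → J, x = Sum.inr ∘ a ∧ SecondSort.lt L G (a 0) (a 1)

/-- The normalized counting measure of a subset of a finite type, as an element of `[0,1]`. -/
def countingMeasure {X : Type*} [Finite X] (S : Set X) : unitInterval :=
  ⟨(S.ncard : ℝ) / (Nat.card X : ℝ), by positivity,
    div_le_one_of_le₀ (by exact_mod_cast S.ncard_le_card) (by positivity)⟩

/-- The canonical `L⁺`-expansion of a finite `L`-structure `A`: the second sort is `[0,1]` with its
order and distance, and `μ_φ(b)` is the normalized counting measure of `φ(A^m; b)`. -/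
instance finiteSecondSort (L : FirstOrder.Language.{u, v}) (A : Type*) [L.Structure A] [Finite A] :
    SecondSort L A unitInterval where
  lt s t := s < t
  dist s t := ⟨|(s : ℝ) - t|, abs_nonneg _,
    abs_le.2 ⟨by linarith [s.2.1, t.2.2], by linarith [s.2.2, t.2.1]⟩⟩
  mu φ b := countingMeasure {a | φ.Realize (Sum.elim a b)}

/-! ### The pseudofinite counting measure -/

section Measure

variable {L : FirstOrder.Language.{u, v}} {ι : Type*} {U : Ultrafilter ι} {A : ι → Type*}
  [∀ i, L.Structure (A i)] [∀ i, Finite (A i)] {G : Type*} [L.Structure G] {J : Type*}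
  [SecondSort L G J]

/-- The image in an elementary extension of the ultraproduct of the standard number `s ∈ [0,1]`. -/
def standardPoint (e : ((U : Filter ι).Product fun i => A i ⊕ unitInterval) ↪ₑ[plus L] (G ⊕ J))
    (s : unitInterval) : G ⊕ J :=
  e ((fun _ => Sum.inr s : ∀ i, A i ⊕ unitInterval) :
    (U : Filter ι).Product fun i => A i ⊕ unitInterval)

/-- The standard part of `j`: the supremum of the `s ∈ [0,1]` with `s ≤ j`. -/
def standardPart (e : ((U : Filter ι).Product fun i => A i ⊕ unitInterval) ↪ₑ[plus L] (G ⊕ J))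
    (j : J) : ℝ :=
  sSup ((fun s : unitInterval => (s : ℝ)) ''
    {s | ¬ Structure.RelMap (L := plus L) (PlusRelations.lt : PlusRelations L 2)
      ![Sum.inr j, standardPoint e s]})

/-- The pseudofinite counting measure `μ(φ(x̄; b̄))`, the standard part of `μ_φ(b̄)`. -/
def measure (e : ((U : Filter ι).Product fun i => A i ⊕ unitInterval) ↪ₑ[plus L] (G ⊕ J))
    {m n : ℕ} (φ : L.Formula (Fin m ⊕ Fin n)) (b : Fin n → G) : ℝ :=
  standardPart e (SecondSort.mu φ b : J)

end Measure

/-! ### Formulas `φ(x)` with parameters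

A formula with parameters is an `L`-formula `φ(x; z̄)` together with a tuple `c` for `z̄`. In
`φ(x; z̄, y)` the last parameter variable is the distinguished variable `y`. -/

section Formulas

variable {L : FirstOrder.Language.{u, v}} {n : ℕ}

/-- The formula `φ^ℓ(x; z̄, y) = φ(y · x; z̄)`. -/
def formulaLeft [GroupLanguage L] (φ : L.Formula (Fin 1 ⊕ Fin n)) :
    L.Formula (Fin 1 ⊕ Fin (n + 1)) :=
  BoundedFormula.subst φ (Sum.elim
    (fun _ => (GroupLanguage.mulSym : L.Functions 2).apply₂ (Term.var (Sum.inr (Fin.last n))) (Term.var (Sum.inl 0)))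
    (fun i => Term.var (Sum.inr i.castSucc)))

/-- The formula `φ^r(x; z̄, y) = φ(x · y; z̄)`. -/
def formulaRight [GroupLanguage L] (φ : L.Formula (Fin 1 ⊕ Fin n)) :
    L.Formula (Fin 1 ⊕ Fin (n + 1)) :=
  BoundedFormula.subst φ (Sum.elim
    (fun _ => (GroupLanguage.mulSym : L.Functions 2).apply₂ (Term.var (Sum.inl 0)) (Term.var (Sum.inr (Fin.last n))))
    (fun i => Term.var (Sum.inr i.castSucc)))

/-- The symmetric difference `φ △ ψ`. -/
def symmDiffFormula {α : Type*} (φ ψ : L.Formula α) : L.Formula α :=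
  (φ ⊓ ∼ψ) ⊔ (ψ ⊓ ∼φ)

/-- The formula `φ(y · x; z̄) △ φ(x; z̄)`. -/
def translateDiff [GroupLanguage L] (φ : L.Formula (Fin 1 ⊕ Fin n)) :
    L.Formula (Fin 1 ⊕ Fin (n + 1)) :=
  symmDiffFormula (formulaLeft φ) (φ.relabel (Sum.map id Fin.castSucc))

/-- The binary relation on `G` defined by `δ(x; c, y)`. -/
def binaryRel {G : Type*} [L.Structure G] (δ : L.Formula (Fin 1 ⊕ Fin (n + 1))) (c : Fin n → G) :
    G → G → Prop :=
  fun x y => δ.Realize (Sum.elim (fun _ => x) (Fin.snoc (α := fun _ => G) c y))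

end Formulas

/-- `R(x; y)` is `k`-NIP. -/
def IsNIPWith {α β : Type*} (R : α → β → Prop) (k : ℕ) : Prop :=
  ¬ ∃ (a : Fin k → α) (b : Set (Fin k) → β), ∀ i X, R (a i) (b X) ↔ i ∈ X

/-- `R(x; y)` is NIP. -/
def IsNIP {α β : Type*} (R : α → β → Prop) : Prop :=
  ∃ k, 1 ≤ k ∧ IsNIPWith R k

/-- `X` is defined by a finite Boolean combination of instances `R(x; b)` with `b ∈ B`. -/
def DefinableBy {α β : Type*} (R : α → β → Prop) (B : Set β) (X : Set α) : Prop :=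
  X ∈ BooleanSubalgebra.closure {S : Set α | ∃ b ∈ B, S = {x | R x b}}

/-- `X` is an intersection of sets that are defined by Boolean combinations of instances of `R`
with parameters in `B`. (There are at most `|B| + ℵ₀` such sets, so the size of the intersection is
controlled by that of `B`.) -/
def TypeDefinableBy {α β : Type*} (R : α → β → Prop) (B : Set β) (X : Set α) : Prop :=
  ∃ S : Set (Set α), (∀ Y ∈ S, DefinableBy R B Y) ∧ X = ⋂₀ S

/-- Finitely many left translates of `X` cover `G`. -/
def LeftGeneric {G : Type*} [Group G] (X : Set G) : Prop :=
  ∃ n : ℕ, 1 ≤ n ∧ ∃ g : Fin n → G, ⋃ i, g i • X = Set.univ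

/-- `Stab^ε_μ(φ) = {g : μ(φ(g⁻¹ x) △ φ(x)) ≤ ε}`, for the formula `φ(x; c)`. -/
def stab {L : FirstOrder.Language.{u, v}} [GroupLanguage L] {ι : Type*} {U : Ultrafilter ι}
    {A : ι → Type*} [∀ i, L.Structure (A i)] [∀ i, Finite (A i)]
    {G : Type*} [L.Structure G] [Group G] {J : Type*} [SecondSort L G J]
    (e : ((U : Filter ι).Product fun i => A i ⊕ unitInterval) ↪ₑ[plus L] (G ⊕ J))
    {n : ℕ} (φ : L.Formula (Fin 1 ⊕ Fin n)) (c : Fin n → G) (ε : ℝ) : Set G :=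
  {g | measure e (translateDiff φ) (Fin.snoc (α := fun _ => G) c g⁻¹) ≤ ε}

end PseudofiniteGroup

end

/-!
By the double sampling argument of Vapnik and Chervonenkis, there is an `N` depending only on `k`
and `η` such that every `k`-NIP relation `R(x; y)` on a finite set has an `N`-tuple of points for
which any two sets `R(x; g)`, `R(x; h)` with the same trace on the tuple differ in measure at most
`η`. Applied to `φ(y · x)`, where `R(x; g) = g⁻¹ S`, this is a property of the `A i` expressible by
one sentence of `L⁺`, hence it holds in `G` as well. Now `ν g = μ(φ(g x) △ φ(x))` is a seminorm on
`G`, and `ν (g / h)` is the measure of the difference of `g⁻¹ S` and `h⁻¹ S`, so up to `η` it is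
controlled by the `φ^r`-types of `g` and `h` over a finite set. There are finitely many such types,
which gives genericity; letting `η` tend to `0` gives countably many parameters, hence the
type-definability of the balls of `ν` and the bound on the index of its kernel.
-/

noncomputable section

namespace PseudofiniteGroup

section EpsilonNet

open Finset Filter
open scoped symmDiff Classical

variable {α β ι κ : Type*} [Fintype ι] [Fintype κ]

/-- The trace of the fibre `R(·, b)` on the family `z`, as a set of indices. -/
def trace (R : α → β → Prop) (z : κ → α) (b : β) : Finset κ := {i | R (z i) b}

/-- The traces on the family `z` of all fibres of `R`. -/
def traces (R : α → β → Prop) (z : κ → α) : Finset (Finset κ) := {T | ∃ b, trace R z b = T}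

@[simp]
theorem mem_trace {R : α → β → Prop} {z : κ → α} {b : β} {i : κ} : i ∈ trace R z b ↔ R (z i) b := by
  simp [trace]

theorem trace_mem_traces (R : α → β → Prop) (z : κ → α) (b : β) : trace R z b ∈ traces R z := by
  simp [traces]

theorem vcDim_traces_le {R : α → β → Prop} {k : ℕ} (hR : IsNIPWith R k)
    (z : κ → α) : (traces R z).vcDim ≤ k := by
  refine Finset.sup_le fun S hS => ?_
  by_contra! hk
  obtain ⟨T, hTS, hT⟩ := exists_subset_card_eq hk.le
  have hshat : (traces R z).Shatters T := (mem_shatterer.1 hS).mono_right hTS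
  let f : Fin k ↪ κ := (T.equivFinOfCardEq hT).symm.toEmbedding.trans (.subtype _)
  have hf (i) : f i ∈ T := ((T.equivFinOfCardEq hT).symm i).2
  have hcut (X : Set (Fin k)) : ∃ b, ∀ i, R (z (f i)) b ↔ i ∈ X := by
    obtain ⟨V, hV, hTV⟩ := hshat (t := ({i | i ∈ X} : Finset (Fin k)).map f)
      fun a ha => by obtain ⟨i, -, rfl⟩ := mem_map.1 ha; exact hf i
    obtain ⟨b, rfl⟩ : ∃ b, trace R z b = V := by simpa [traces] using hV
    exact ⟨b, fun i => by simpa [hf] using Finset.ext_iff.1 hTV (f i)⟩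
  choose b hb using hcut
  exact hR ⟨z ∘ f, b, fun i X => hb X i⟩

theorem card_le_of_vcDim_le {𝒜 : Finset (Finset κ)} {k : ℕ} (h : 𝒜.vcDim ≤ k) :
    𝒜.card ≤ (Fintype.card κ + 1) ^ k :=
  calc 𝒜.card ≤ 𝒜.shatterer.card := card_le_card_shatterer _
    _ ≤ ∑ i ∈ Iic 𝒜.vcDim, (Fintype.card κ).choose i := card_shatterer_le_sum_vcDim
    _ ≤ ∑ i ∈ Iic k, (Fintype.card κ).choose i := sum_le_sum_of_subset (Iic_subset_Iic.2 h)
    _ ≤ ∑ i ∈ Iic k, Fintype.card κ ^ i * k.choose i := sum_le_sum fun i hi =>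
        (Nat.choose_le_pow _ _).trans
          (Nat.le_mul_of_pos_right _ (Nat.choose_pos (mem_Iic.1 hi)))
    _ = (Fintype.card κ + 1) ^ k := by
        simp [add_pow, ← Nat.range_succ_eq_Iic]

/-- The relation whose fibres are the symmetric differences of two fibres of `R`. -/
def symmDiffRel (R : α → β → Prop) (a : α) (b : β × β) : Prop := a ∈ {x | R x b.1} ∆ {x | R x b.2}

theorem card_traces_symmDiffRel_le (R : α → β → Prop) (z : κ → α) :
    (traces (symmDiffRel R) z).card ≤ (traces R z).card ^ 2 := by
  calc (traces (symmDiffRel R) z).card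
      ≤ ((traces R z ×ˢ traces R z).image fun T => T.1 ∆ T.2).card := by
        refine card_le_card fun T hT => ?_
        obtain ⟨b, rfl⟩ : ∃ b, trace (symmDiffRel R) z b = T := by simpa [traces] using hT
        refine mem_image.2 ⟨(trace R z b.1, trace R z b.2),
          mem_product.2 ⟨trace_mem_traces R z _, trace_mem_traces R z _⟩, ?_⟩
        ext i
        simp [symmDiffRel, mem_symmDiff, Set.mem_symmDiff]
    _ ≤ (traces R z ×ˢ traces R z).card := card_image_le
    _ = (traces R z).card ^ 2 := by rw [card_product, sq]

/-- A set of cells of the table `Bool × ι` that avoids the first sample `{false} × ι` and has at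
least `s` cells in the second sample `{true} × ι`. -/
def IsLopsided (s : ℕ) (T : Finset (Bool × ι)) : Prop :=
  (∀ j, (false, j) ∉ T) ∧ s ≤ Finset.card {j | (true, j) ∈ T}

/-- The permutation of the table `Bool × ι` that exchanges the two cells in the columns `j` with
`σ j = true`. -/
def columnSwap (σ : ι → Bool) : Equiv.Perm (Bool × ι) :=
  Function.Involutive.toPerm (fun p => (xor p.1 (σ p.2), p.2)) fun p => by simp

theorem trace_comp_columnSwap (R : α → β → Prop) (z : Bool × ι → α) (b : β) (σ : ι → Bool) :
    trace R (z ∘ columnSwap σ) b = (trace R z b).map (columnSwap σ).toEmbedding := by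
  ext p
  rw [mem_map_equiv, mem_trace, mem_trace]
  rfl

/-- A column meeting `T` can be swapped in at most one way when the first sample is to avoid `T`,
and there are at least `s` such columns. -/
theorem card_isLopsided_columnSwap_mul_le (s : ℕ) (T : Finset (Bool × ι)) :
    Finset.card {σ : ι → Bool | IsLopsided s (T.map (columnSwap σ).toEmbedding)} * 2 ^ s ≤
      2 ^ Fintype.card ι := by
  set W : Finset (ι → Bool) := {σ | IsLopsided s (T.map (columnSwap σ).toEmbedding)}
  have hmem (σ : ι → Bool) (b : Bool) (j : ι) :
      (b, j) ∈ T.map (columnSwap σ).toEmbedding ↔ (xor b (σ j), j) ∈ T := mem_map_equiv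
  have hW {σ : ι → Bool} : σ ∈ W ↔
      (∀ j, (σ j, j) ∉ T) ∧ s ≤ Finset.card {j | (!σ j, j) ∈ T} := by
    simp only [W, mem_filter_univ, IsLopsided, hmem, Bool.false_xor, Bool.true_xor]
  rcases W.eq_empty_or_nonempty with hempty | ⟨σ₀, hσ₀⟩
  · simp [hempty]
  let I : Finset ι := {j | ∃ b, (b, j) ∈ T}
  have hsI : s ≤ I.card := (hW.1 hσ₀).2.trans <| card_le_card fun j hj =>
    mem_filter_univ j |>.2 ⟨_, (mem_filter_univ j).1 hj⟩
  have hcard : W.card ≤ Fintype.card ({j // j ∈ Iᶜ} → Bool) := by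
    refine card_le_card_of_injOn (fun σ j => σ j) (fun _ _ => mem_univ _) ?_
    intro σ hσ τ hτ hστ
    funext j
    by_cases hj : j ∈ I
    · obtain ⟨b, hb⟩ := (mem_filter_univ j).1 hj
      have forced {ρ : ι → Bool} (hρ : ρ ∈ W) : ρ j = !b :=
        Bool.eq_not.2 fun h => (hW.1 hρ).1 j (h ▸ hb)
      rw [forced hσ, forced hτ]
    · exact congrFun hστ ⟨j, mem_compl.2 hj⟩
  rw [Fintype.card_fun, Fintype.card_bool, Fintype.card_coe, card_compl] at hcard
  calc W.card * 2 ^ s ≤ 2 ^ (Fintype.card ι - I.card) * 2 ^ I.card :=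
        Nat.mul_le_mul hcard (Nat.pow_le_pow_right two_pos hsI)
    _ = 2 ^ Fintype.card ι := by rw [← pow_add, Nat.sub_add_cancel (card_le_univ I)]

theorem card_lopsided_swaps_mul_le (R : α → β → Prop) (s : ℕ) (z : Bool × ι → α) :
    Finset.card {σ : ι → Bool | ∃ b, IsLopsided s (trace R (z ∘ columnSwap σ) b)} * 2 ^ s ≤
      (traces R z).card * 2 ^ Fintype.card ι := by
  let F (T : Finset (Bool × ι)) : Finset (ι → Bool) :=
    {σ | IsLopsided s (T.map (columnSwap σ).toEmbedding)}
  have hsub : ({σ | ∃ b, IsLopsided s (trace R (z ∘ columnSwap σ) b)} : Finset (ι → Bool)) ⊆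
      (traces R z).biUnion F := by
    intro σ hσ
    obtain ⟨b, hb⟩ := (mem_filter_univ σ).1 hσ
    rw [trace_comp_columnSwap] at hb
    exact mem_biUnion.2 ⟨_, trace_mem_traces R z b, (mem_filter_univ σ).2 hb⟩
  calc _ ≤ (∑ T ∈ traces R z, (F T).card) * 2 ^ s :=
        Nat.mul_le_mul_right _ ((card_le_card hsub).trans card_biUnion_le)
    _ = ∑ T ∈ traces R z, (F T).card * 2 ^ s := sum_mul _ _ _
    _ ≤ ∑ _T ∈ traces R z, 2 ^ Fintype.card ι :=
        sum_le_sum fun T _ => card_isLopsided_columnSwap_mul_le s T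
    _ = _ := by rw [sum_const, smul_eq_mul]

section FinitePoints

variable [Fintype α]

theorem sum_card_hits (D : Finset α) :
    ∑ y : ι → α, Finset.card {j | y j ∈ D} =
      Fintype.card ι * (Fintype.card α ^ (Fintype.card ι - 1) * D.card) := by
  calc ∑ y : ι → α, Finset.card {j | y j ∈ D}
      = ∑ j : ι, ∑ y : ι → α, if y j ∈ D then 1 else 0 := by
        simp_rw [card_filter]
        exact sum_comm
    _ = ∑ _j : ι, Fintype.card α ^ (Fintype.card ι - 1) * D.card := by
        refine sum_congr rfl fun j _ => ?_
        rw [← Fintype.piFinset_univ,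
          Fintype.sum_piFinset_apply (fun a => if a ∈ D then 1 else 0) univ j]
        simp
    _ = _ := by simp

theorem le_card_tuples_with_many_hits [Nonempty ι] (D : Finset α)
    {η : ℝ} {s : ℕ} (hD : η * Fintype.card α ≤ D.card) (hs : (s : ℝ) ≤ η * Fintype.card ι / 2) :
    η / 2 * (Fintype.card α : ℝ) ^ Fintype.card ι ≤
      Finset.card {y : ι → α | s ≤ Finset.card {j | y j ∈ D}} := by
  set n := Fintype.card ι
  set q := Fintype.card α
  set P := Finset.card {y : ι → α | s ≤ Finset.card {j | y j ∈ D}}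
  have hn : 0 < n := Fintype.card_pos
  have hsum : n * (q ^ (n - 1) * D.card) ≤ n * P + s * q ^ n := by
    calc n * (q ^ (n - 1) * D.card) = ∑ y : ι → α, Finset.card {j | y j ∈ D} :=
          (sum_card_hits D).symm
      _ ≤ ∑ y : ι → α, (n * (if s ≤ Finset.card {j | y j ∈ D} then 1 else 0) + s) := by
          refine sum_le_sum fun y _ => ?_
          have : Finset.card {j | y j ∈ D} ≤ n := card_le_univ _
          split_ifs <;> omega
      _ = n * P + s * q ^ n := by
          rw [sum_add_distrib, ← mul_sum, ← card_filter]
          simp [P, q, n, mul_comm]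
  have hdense : η * (q : ℝ) ^ n ≤ (q : ℝ) ^ (n - 1) * D.card := by
    calc η * (q : ℝ) ^ n = q ^ (n - 1) * (η * q) := by
          rw [← mul_left_comm, ← pow_succ, Nat.sub_add_cancel hn]
      _ ≤ q ^ (n - 1) * D.card := by gcongr
  have hn' : (0 : ℝ) < n := Nat.cast_pos.2 hn
  refine le_of_mul_le_mul_left ?_ hn'
  calc n * (η / 2 * (q : ℝ) ^ n) = n * (η * q ^ n) - η * n / 2 * q ^ n := by ring
    _ ≤ n * (q ^ (n - 1) * D.card) - s * q ^ n := by gcongr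
    _ ≤ n * P := by
        rw [sub_le_iff_le_add]
        exact_mod_cast hsum

theorem card_lopsided_tables_mul_le {R : α → β → Prop} {K : ℕ}
    (hK : ∀ z : Bool × ι → α, (traces R z).card ≤ K) (s : ℕ) :
    Finset.card {z : Bool × ι → α | ∃ b, IsLopsided s (trace R z b)} * 2 ^ s ≤
      K * (Fintype.card α ^ Fintype.card ι) ^ 2 := by
  set W : Finset (Bool × ι → α) := {z | ∃ b, IsLopsided s (trace R z b)}
  let swaps (z : Bool × ι → α) : Finset (ι → Bool) :=
    {σ | ∃ b, IsLopsided s (trace R (z ∘ columnSwap σ) b)}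
  have hsymm (σ : ι → Bool) : W.card = Finset.card {z | z ∘ columnSwap σ ∈ W} :=
    (card_equiv ((columnSwap σ).symm.arrowCongr (.refl α)) fun z => mem_filter_univ z).symm
  have hcount : 2 ^ Fintype.card ι * W.card = ∑ z, (swaps z).card :=
    calc 2 ^ Fintype.card ι * W.card = ∑ _σ : ι → Bool, W.card := by simp
      _ = ∑ σ : ι → Bool, Finset.card {z | z ∘ columnSwap σ ∈ W} :=
          sum_congr rfl fun σ _ => hsymm σ
      _ = ∑ z, (swaps z).card := by
          simp_rw [W, swaps, mem_filter_univ, card_filter]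
          exact sum_comm
  refine le_of_mul_le_mul_left ?_ (pow_pos two_pos (Fintype.card ι))
  calc 2 ^ Fintype.card ι * (W.card * 2 ^ s) = ∑ z, (swaps z).card * 2 ^ s := by
        rw [← mul_assoc, hcount, sum_mul]
    _ ≤ ∑ _z : Bool × ι → α, K * 2 ^ Fintype.card ι := sum_le_sum fun z _ =>
        (card_lopsided_swaps_mul_le R s z).trans (Nat.mul_le_mul_right _ (hK z))
    _ = 2 ^ Fintype.card ι * (K * (Fintype.card α ^ Fintype.card ι) ^ 2) := by
        rw [sum_const, card_univ, Fintype.card_fun, Fintype.card_prod, Fintype.card_bool, pow_mul',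
          smul_eq_mul]
        ring

theorem le_card_lopsided_tables [Nonempty ι] {R : α → β → Prop} {η : ℝ} {s : ℕ}
    (hs : (s : ℝ) ≤ η * Fintype.card ι / 2)
    (hmiss : ∀ x : ι → α, ∃ b, (∀ j, ¬ R (x j) b) ∧
      η * Fintype.card α ≤ Finset.card {a | R a b}) :
    η / 2 * ((Fintype.card α : ℝ) ^ Fintype.card ι) ^ 2 ≤
      Finset.card {z : Bool × ι → α | ∃ b, IsLopsided s (trace R z b)} := by
  choose b hb hbig using hmiss
  let Q : Finset ((ι → α) × (ι → α)) := {p | s ≤ Finset.card {j | R (p.2 j) (b p.1)}}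
  let glue : (ι → α) × (ι → α) ≃ (Bool × ι → α) :=
    ((Equiv.curry Bool ι α).trans (Equiv.boolArrowEquivProd _)).symm
  have hglue : Q.card ≤ Finset.card {z : Bool × ι → α | ∃ b, IsLopsided s (trace R z b)} := by
    refine card_le_card_of_injOn glue (fun p hp => ?_) glue.injective.injOn
    refine mem_coe.2 ((mem_filter_univ _).2 ⟨b p.1, fun j => ?_, ?_⟩)
    · simpa [glue] using hb p.1 j
    · simpa [glue, Q] using hp
  calc η / 2 * ((Fintype.card α : ℝ) ^ Fintype.card ι) ^ 2
      = ∑ _x : ι → α, η / 2 * (Fintype.card α : ℝ) ^ Fintype.card ι := by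
        rw [sum_const, card_univ, Fintype.card_fun, nsmul_eq_mul, Nat.cast_pow]
        ring
    _ ≤ ∑ x : ι → α, (Finset.card {y : ι → α | s ≤ Finset.card {j | R (y j) (b x)}} : ℝ) :=
        sum_le_sum fun x _ => by
          simpa using le_card_tuples_with_many_hits {a | R a (b x)} (hbig x) hs
    _ = Q.card := by
        simp only [Q, card_filter, Fintype.sum_prod_type, Nat.cast_sum]
    _ ≤ _ := Nat.cast_le.2 hglue

end FinitePoints

/-- The `ε`-net theorem of Vapnik and Chervonenkis. -/
theorem exists_hitting_tuple [Finite α] [Nonempty α] [Nonempty ι] {R : α → β → Prop}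
    {K s : ℕ} {η : ℝ} (hK : ∀ z : Bool × ι → α, (traces R z).card ≤ K)
    (hs : (s : ℝ) ≤ η * Fintype.card ι / 2) (hKs : 2 * (K : ℝ) < η * 2 ^ s) :
    ∃ x : ι → α, ∀ b, (∀ j, ¬ R (x j) b) → (countingMeasure {a | R a b} : ℝ) ≤ η := by
  have := Fintype.ofFinite α
  by_contra! hmiss
  have hcard (b : β) : (countingMeasure {a | R a b} : ℝ) =
      (Finset.card {a | R a b} : ℝ) / Fintype.card α := by
    simp [countingMeasure, Set.ncard_eq_toFinset_card']
  have hq : (0 : ℝ) < Fintype.card α := Nat.cast_pos.2 Fintype.card_pos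
  have hlower := le_card_lopsided_tables (R := R) hs fun x =>
    (hmiss x).imp fun b hb => ⟨hb.1, ((lt_div_iff₀ hq).1 (hcard b ▸ hb.2)).le⟩
  have hupper : (Finset.card {z : Bool × ι → α | ∃ b, IsLopsided s (trace R z b)} : ℝ) * 2 ^ s ≤
      K * ((Fintype.card α : ℝ) ^ Fintype.card ι) ^ 2 := by
    exact_mod_cast card_lopsided_tables_mul_le hK s
  have hlow' := mul_le_mul_of_nonneg_right hlower (show (0 : ℝ) ≤ 2 ^ s by positivity)
  have hpos : (0 : ℝ) < ((Fintype.card α : ℝ) ^ Fintype.card ι) ^ 2 := by positivity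
  linarith [mul_lt_mul_of_pos_right hKs hpos]

theorem exists_sample_size (d : ℕ) {η : ℝ} (hη : 0 < η) :
    ∃ N s : ℕ, 0 < N ∧ (s : ℝ) ≤ η * N / 2 ∧ 2 * (2 * N + 1 : ℝ) ^ d < η * 2 ^ s := by
  obtain ⟨t, ht⟩ := exists_nat_gt (2 / η)
  have ht0 : 0 < t := Nat.cast_pos.1 ((div_pos two_pos hη).trans ht)
  rw [div_lt_iff₀' hη] at ht
  have hlim := (tendsto_pow_const_div_const_pow_of_one_lt d (one_lt_two (α := ℝ))).const_mul
    (2 * (2 * t + 1 : ℝ) ^ d)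
  rw [mul_zero] at hlim
  obtain ⟨s, hs, hs0⟩ := ((hlim.eventually_lt_const hη).and (eventually_gt_atTop 0)).exists
  rw [← mul_div_assoc, div_lt_iff₀ (by positivity)] at hs
  refine ⟨s * t, s, Nat.mul_pos hs0 ht0, ?_, lt_of_le_of_lt ?_ hs⟩
  · have : (s : ℝ) * 2 ≤ s * (η * t) := by gcongr
    push_cast
    linarith
  · have hs1 : (1 : ℝ) ≤ s := Nat.one_le_cast.2 hs0
    rw [mul_assoc, ← mul_pow]
    gcongr
    push_cast
    linarith

theorem exists_separating_tuple (k : ℕ) {η : ℝ} (hη : 0 < η) :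
    ∃ N : ℕ, ∀ (α β : Type*) [Finite α] [Nonempty α] (R : α → β → Prop), IsNIPWith R k →
      ∃ x : Fin N → α, ∀ g h, (∀ j, R (x j) g ↔ R (x j) h) →
        (countingMeasure ({a | R a g} ∆ {a | R a h}) : ℝ) ≤ η := by
  obtain ⟨N, s, hN, hs, hlarge⟩ := exists_sample_size (k * 2) hη
  refine ⟨N, fun α β _ _ R hR => ?_⟩
  have : NeZero N := ⟨hN.ne'⟩
  have htraces (z : Bool × Fin N → α) :
      (traces (symmDiffRel R) z).card ≤ (2 * N + 1) ^ (k * 2) := by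
    calc (traces (symmDiffRel R) z).card ≤ (traces R z).card ^ 2 :=
          card_traces_symmDiffRel_le R z
      _ ≤ ((2 * N + 1) ^ k) ^ 2 := by
          gcongr
          simpa using card_le_of_vcDim_le (vcDim_traces_le hR z)
      _ = (2 * N + 1) ^ (k * 2) := (pow_mul _ _ _).symm
  obtain ⟨x, hx⟩ := exists_hitting_tuple htraces (s := s) (by simpa using hs)
    (by exact_mod_cast hlarge)
  refine ⟨x, fun g h hgh => hx (g, h) fun j => ?_⟩
  simp [symmDiffRel, Set.mem_symmDiff, hgh j]

end EpsilonNet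

section FinitelySeparated

variable {α β G : Type*} [Group G]

/-- The `R`-type of `x` over `B`, as the set of those `b ∈ B` for which `R(x, b)` holds. -/
def typeOver (R : α → β → Prop) (B : Set β) (x : α) : Set B := {b | R x b}

theorem definableBy_preimage_typeOver (R : α → β → Prop) {F B : Set β} [Finite F] (hFB : F ⊆ B)
    (𝒯 : Set (Set F)) : DefinableBy R B (typeOver R F ⁻¹' 𝒯) := by
  have definableBy_fiber (t : Set F) : DefinableBy R B (typeOver R F ⁻¹' {t}) := by
    classical
    have hfiber : typeOver R F ⁻¹' {t} = ⨅ b : F, if b ∈ t then {x | R x b} else {x | R x b}ᶜ := by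
      ext x
      simp only [Set.mem_preimage, Set.mem_singleton_iff, Set.ext_iff, typeOver, Set.iInf_eq_iInter,
        Set.mem_iInter]
      refine forall_congr' fun b => ?_
      by_cases hb : b ∈ t <;> simp [hb]
    have hmem (b : F) : {x | R x b} ∈
        BooleanSubalgebra.closure {S : Set α | ∃ b ∈ B, S = {x | R x b}} :=
      BooleanSubalgebra.subset_closure ⟨b, hFB b.2, rfl⟩
    rw [hfiber]
    refine BooleanSubalgebra.iInf_mem fun b => ?_
    split_ifs
    exacts [hmem b, BooleanSubalgebra.compl_mem (hmem b)]
  rw [← Set.biUnion_of_singleton 𝒯, Set.preimage_iUnion₂]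
  exact BooleanSubalgebra.biSup_mem 𝒯.toFinite fun t _ => definableBy_fiber t

/-- The seminorm `ν` is finitely separated by `R` if, for every `η > 0`, the classes of equal
`R`-type over some finite set have `ν`-diameter at most `η`. -/
def FinitelySeparated (ν : GroupSeminorm G) (R : G → β → Prop) : Prop :=
  ∀ η : ℝ, 0 < η → ∃ F : Set β, F.Finite ∧
    ∀ g h, typeOver R F g = typeOver R F h → ν (g / h) ≤ η

/-- The group seminorm given by a function that vanishes at `1` and is subadditive for division. -/
def seminormOfDiv (f : G → ℝ) (h_one : f 1 = 0) (h_div : ∀ g h, f (g / h) ≤ f g + f h) :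
    GroupSeminorm G :=
  have h_inv (g : G) : f g⁻¹ ≤ f g := by simpa [h_one] using h_div 1 g
  { toFun := f
    map_one' := h_one
    mul_le' := fun g h => by
      simpa using (h_div g h⁻¹).trans (add_le_add_right (h_inv h) _)
    inv' := fun g => (h_inv g).antisymm (by simpa using h_inv g⁻¹) }

/-- The subgroup on which the seminorm `ν` vanishes. -/
def zeroSubgroup (ν : GroupSeminorm G) : Subgroup G where
  carrier := {g | ν g = 0}
  one_mem' := map_one_eq_zero ν
  mul_mem' {a b} ha hb := le_antisymm
    ((map_mul_le_add ν a b).trans_eq (by rw [ha, hb, add_zero])) (apply_nonneg ν _)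
  inv_mem' {a} ha := (map_inv_eq_map ν a).trans ha

theorem coe_zeroSubgroup (ν : GroupSeminorm G) : (zeroSubgroup ν : Set G) = {g | ν g ≤ 0} :=
  Set.ext fun g => ((apply_nonneg ν g).ge_iff_eq').symm

variable {ν : GroupSeminorm G} {R : G → β → Prop}

theorem FinitelySeparated.leftGeneric (h : FinitelySeparated ν R) {ε : ℝ} (hε : 0 < ε) :
    LeftGeneric {g | ν g ≤ ε} := by
  obtain ⟨F, hF, hsep⟩ := h ε hε
  have : Finite F := hF
  let tp (g : G) : Set F := typeOver R F g⁻¹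
  have : Nonempty (Set.range tp) := (Set.range_nonempty tp).to_subtype
  refine ⟨Nat.card (Set.range tp), Nat.card_pos,
    Set.rangeSplitting tp ∘ (Finite.equivFin _).symm, Set.eq_univ_of_forall fun g => ?_⟩
  let t : Set.range tp := ⟨tp g, Set.mem_range_self g⟩
  have ht : ν ((Set.rangeSplitting tp t)⁻¹ / g⁻¹) ≤ ε := hsep _ _ (Set.apply_rangeSplitting tp t)
  refine Set.mem_iUnion.2 ⟨Finite.equivFin _ t, ?_⟩
  rw [Function.comp_apply, Equiv.symm_apply_apply]
  simpa [Set.mem_smul_set_iff_inv_smul_mem] using ht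

theorem FinitelySeparated.exists_typeDefinableBy (h : FinitelySeparated ν R) (ε : ℝ) :
    ∃ B : Set β, B.Countable ∧ TypeDefinableBy R B {g | ν g ≤ ε} := by
  choose F hF hsep using fun m : ℕ => h (1 / (m + 1)) Nat.one_div_pos_of_nat
  have (m : ℕ) : Finite (F m) := hF m
  let 𝒯 (m : ℕ) : Set (Set (F m)) := typeOver R (F m) '' {g | ν g ≤ ε}
  refine ⟨⋃ m, F m, Set.countable_iUnion fun m => (hF m).countable,
    Set.range fun m => typeOver R (F m) ⁻¹' 𝒯 m, ?_, ?_⟩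
  · rintro _ ⟨m, rfl⟩
    exact definableBy_preimage_typeOver R (Set.subset_iUnion F m) (𝒯 m)
  · rw [Set.sInter_range]
    refine Set.Subset.antisymm
      (Set.subset_iInter fun m => Set.subset_preimage_image _ _) fun g hg => ?_
    have hle (m : ℕ) : ν g ≤ 1 / ((m : ℝ) + 1) + ε := by
      obtain ⟨g', hg', htp⟩ := Set.mem_iInter.1 hg m
      calc ν g = ν (g / g' * g') := by rw [div_mul_cancel]
        _ ≤ ν (g / g') + ν g' := map_mul_le_add ν _ _
        _ ≤ 1 / ((m : ℝ) + 1) + ε := add_le_add (hsep m g g' htp.symm) hg'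
    have hlim := (tendsto_one_div_add_atTop_nhds_zero_nat (𝕜 := ℝ)).add_const ε
    rw [zero_add] at hlim
    exact ge_of_tendsto' hlim hle

theorem FinitelySeparated.exists_countable (h : FinitelySeparated ν R) :
    ∃ B : Set β, B.Countable ∧ ∀ g h, typeOver R B g = typeOver R B h → ν (g / h) = 0 := by
  choose F hF hsep using fun m : ℕ => h (1 / (m + 1)) Nat.one_div_pos_of_nat
  refine ⟨⋃ m, F m, Set.countable_iUnion fun m => (hF m).countable, fun g h hgh => ?_⟩
  refine le_antisymm ?_ (apply_nonneg ν _)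
  refine ge_of_tendsto' tendsto_one_div_add_atTop_nhds_zero_nat fun m => hsep m g h ?_
  ext b
  exact Set.ext_iff.1 hgh ⟨b, Set.mem_iUnion_of_mem m b.2⟩

theorem FinitelySeparated.mk_quotient_le_continuum (h : FinitelySeparated ν R) :
    #(G ⧸ zeroSubgroup ν) ≤ 𝔠 := by
  obtain ⟨B, hB, hsep⟩ := h.exists_countable
  let code (q : G ⧸ zeroSubgroup ν) : Set B := typeOver R B q.out⁻¹
  have hcode : Function.Injective code := fun p q hpq => by
    rw [← p.out_eq', ← q.out_eq', QuotientGroup.eq]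
    simpa [zeroSubgroup] using hsep _ _ hpq
  rw [← Cardinal.lift_le_continuum]
  refine (Cardinal.lift_mk_le_lift_mk_of_injective hcode).trans ?_
  rw [Cardinal.lift_le_continuum, Cardinal.mk_set]
  exact Cardinal.power_le_power_left two_ne_zero hB.le_aleph0

end FinitelySeparated

section Relativization

variable {L : FirstOrder.Language.{u, v}}

/-- A function symbol of `L` as a symbol of `L⁺`. -/
def baseFun {n : ℕ} (f : L.Functions n) : (plus L).Functions n := PlusFunctions.base f

/-- The symbol `μ_θ` of `L⁺`. -/
def muFun {m n : ℕ} (θ : L.Formula (Fin m ⊕ Fin n)) : (plus L).Functions n := PlusFunctions.mu θ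

/-- A relation symbol of `L` as a symbol of `L⁺`. -/
def baseRel {n : ℕ} (R : L.Relations n) : (plus L).Relations n := PlusRelations.base R

variable (L) in
/-- The predicate of `L⁺` for the home sort. -/
def homeSym : (plus L).Relations 1 := PlusRelations.home (L := L)

variable (L) in
/-- The symbol `<` of `L⁺`. -/
def ltSym : (plus L).Relations 2 := PlusRelations.lt (L := L)

/-- An `L`-term as an `L⁺`-term. -/
def plusTerm {α : Type*} : L.Term α → (plus L).Term α
  | .var a => .var a
  | .func f ts => .func (baseFun f) fun i => plusTerm (ts i)

/-- The `L⁺`-formula expressing that a term belongs to the home sort. -/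
def isHome {α : Type*} {n : ℕ} (t : (plus L).Term (α ⊕ Fin n)) : (plus L).BoundedFormula α n :=
  Relations.boundedFormula₁ (homeSym L) t

/-- An `L`-formula as an `L⁺`-formula, with quantifiers relativized to the home sort. -/
def relativize {α : Type*} : ∀ {n : ℕ}, L.BoundedFormula α n → (plus L).BoundedFormula α n
  | _, .falsum => .falsum
  | _, .equal t₁ t₂ => .equal (plusTerm t₁) (plusTerm t₂)
  | _, .rel R ts => .rel (baseRel R) fun i => plusTerm (ts i)
  | _, .imp φ ψ => .imp (relativize φ) (relativize ψ)
  | _, .all φ => .all ((isHome (Term.var (Sum.inr (Fin.last _)))).imp (relativize φ))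

variable {G : Type*} [L.Structure G] {J : Type*} [SecondSort L G J] {α β : Type*}

theorem extendSort_comp {α M : Type*} {n : ℕ} {i : α → M} (hi : Function.Injective i)
    (f : (Fin n → α) → M) (a : Fin n → α) : extendSort i f (i ∘ a) = f a := by
  have h : ∃ b : Fin n → α, i ∘ a = i ∘ b := ⟨a, rfl⟩
  rw [extendSort, dif_pos h]
  exact congrArg f (hi.comp_left h.choose_spec).symm

theorem funMap_muFun {m n : ℕ} (θ : L.Formula (Fin m ⊕ Fin n)) (b : Fin n → G) :
    Structure.funMap (muFun θ) (fun i => (Sum.inl (b i) : G ⊕ J)) =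
      Sum.inr (SecondSort.mu θ b : J) :=
  extendSort_comp (Sum.inl_injective (α := G) (β := J))
    (fun a : _ → G => Sum.inr (SecondSort.mu θ a)) b

theorem relMap_baseRel {n : ℕ} (R : L.Relations n) (a : Fin n → G) :
    Structure.RelMap (baseRel R) (fun i => (Sum.inl (a i) : G ⊕ J)) ↔ Structure.RelMap R a := by
  refine ⟨?_, fun h => ⟨a, rfl, h⟩⟩
  rintro ⟨b, hab, hb⟩
  rwa [show a = b from funext fun i => Sum.inl_injective (congrFun hab i)]

theorem realize_isHome {n : ℕ} (t : (plus L).Term (α ⊕ Fin n)) (v : α → G ⊕ J)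
    (xs : Fin n → G ⊕ J) :
    (isHome t).Realize v xs ↔ ∃ g : G, t.realize (Sum.elim v xs) = Sum.inl g :=
  BoundedFormula.realize_rel₁

theorem realize_plusTerm (t : L.Term α) (v : α → G) :
    (plusTerm t).realize (fun a => (Sum.inl (v a) : G ⊕ J)) = Sum.inl (t.realize v) := by
  induction t with
  | var a => rfl
  | func f ts ih =>
    simp only [plusTerm, Term.realize, ih]
    exact extendSort_comp Sum.inl_injective _ fun i => (ts i).realize v

theorem realize_relativize_bounded {n : ℕ} (φ : L.BoundedFormula α n) (v : α → G)
    (xs : Fin n → G) :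
    (relativize φ).Realize (fun a => (Sum.inl (v a) : G ⊕ J)) (fun i => Sum.inl (xs i)) ↔
      φ.Realize v xs := by
  have elim_inl {n : ℕ} (xs : Fin n → G) :
      Sum.elim (fun a => (Sum.inl (v a) : G ⊕ J)) (fun i => Sum.inl (xs i)) =
        fun a => Sum.inl (Sum.elim v xs a) := (Sum.comp_elim _ _ _).symm
  induction φ with
  | falsum => exact Iff.rfl
  | equal t₁ t₂ =>
    simp only [relativize, BoundedFormula.Realize, elim_inl, realize_plusTerm,
      Sum.inl_injective.eq_iff]
  | rel R ts =>
    simp only [relativize, BoundedFormula.Realize, elim_inl, realize_plusTerm]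
    exact relMap_baseRel R _
  | imp φ ψ ih₁ ih₂ => simp only [relativize, BoundedFormula.Realize, ih₁, ih₂]
  | all φ ih =>
    simp only [relativize, BoundedFormula.realize_all, BoundedFormula.realize_imp, realize_isHome,
      Term.realize_var, Sum.elim_inr, Fin.snoc_last]
    have snoc_inl (g : G) : Fin.snoc (α := fun _ => G ⊕ J) (fun i => Sum.inl (xs i)) (Sum.inl g) =
        fun i => Sum.inl (Fin.snoc (α := fun _ => G) xs g i) := (Fin.comp_snoc Sum.inl xs g).symm
    constructor
    · intro h g
      refine (ih _).1 ?_
      rw [← snoc_inl]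
      exact h _ ⟨g, rfl⟩
    · rintro h _ ⟨g, rfl⟩
      rw [snoc_inl]
      exact (ih _).2 (h g)

theorem realize_relativize_relabel (φ : L.Formula α) {f : α → β} {v : β → G ⊕ J} {w : α → G}
    (h : v ∘ f = Sum.inl ∘ w) :
    Formula.Realize (Formula.relabel f (relativize φ)) v ↔ φ.Realize w := by
  rw [Formula.realize_relabel, h, Formula.Realize, Formula.Realize,
    ← realize_relativize_bounded (J := J) φ w default]
  exact iff_of_eq (congrArg _ (Subsingleton.elim _ _))

theorem realize_iInf_isHome [Finite β] (v : α ⊕ β → G ⊕ J) :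
    (Formula.iInf fun b : β => isHome (L := L) (α := α ⊕ β)
      (Term.var (Sum.inl (Sum.inr b)))).Realize v ↔
      ∃ a : β → G, v ∘ Sum.inr = Sum.inl ∘ a := by
  rw [Formula.realize_iInf]
  simp only [Formula.Realize, realize_isHome, Term.realize_var, Sum.elim_inl, Classical.skolem,
    funext_iff, Function.comp_apply]

/-- Universal quantification over a finite tuple from the home sort. -/
def homeAlls (β : Type*) [Finite β] (ψ : (plus L).Formula (α ⊕ β)) : (plus L).Formula α :=
  Formula.iAlls β
    (Formula.imp (Formula.iInf fun b : β => isHome (Term.var (Sum.inl (Sum.inr b)))) ψ)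

/-- Existential quantification over a finite tuple from the home sort. -/
def homeExs (β : Type*) [Finite β] (ψ : (plus L).Formula (α ⊕ β)) : (plus L).Formula α :=
  Formula.iExs β ((Formula.iInf fun b : β => isHome (Term.var (Sum.inl (Sum.inr b)))) ⊓ ψ)

theorem realize_homeAlls [Finite β] (ψ : (plus L).Formula (α ⊕ β)) (v : α → G ⊕ J) :
    (homeAlls β ψ).Realize v ↔ ∀ a : β → G, ψ.Realize (Sum.elim v (Sum.inl ∘ a)) := by
  rw [homeAlls, Formula.realize_iAlls]
  simp only [Formula.realize_imp, realize_iInf_isHome, Sum.elim_comp_inr]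
  exact ⟨fun h a => h _ ⟨a, rfl⟩, by rintro h _ ⟨a, rfl⟩; exact h a⟩

theorem realize_homeExs [Finite β] (ψ : (plus L).Formula (α ⊕ β)) (v : α → G ⊕ J) :
    (homeExs β ψ).Realize v ↔ ∃ a : β → G, ψ.Realize (Sum.elim v (Sum.inl ∘ a)) := by
  rw [homeExs, Formula.realize_iExs]
  simp only [Formula.realize_inf, realize_iInf_isHome, Sum.elim_comp_inr]
  exact ⟨by rintro ⟨_, ⟨a, rfl⟩, h⟩; exact ⟨a, h⟩, fun ⟨a, h⟩ => ⟨_, ⟨a, rfl⟩, h⟩⟩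

variable (L) in
/-- The interpretation of the symbol `<` of `L⁺` on the disjoint union of the two sorts. -/
def PlusLT (x y : G ⊕ J) : Prop := Structure.RelMap (ltSym L) ![x, y]

theorem plusLT_inr (s t : J) :
    PlusLT L (Sum.inr s : G ⊕ J) (Sum.inr t) ↔ SecondSort.lt L G s t := by
  constructor
  · rintro ⟨a, ha, h⟩
    rwa [show s = a 0 from Sum.inr_injective (congrFun ha 0),
      show t = a 1 from Sum.inr_injective (congrFun ha 1)]
  · exact fun h => ⟨![s, t], by funext i; fin_cases i <;> rfl, h⟩

/-- The `L⁺`-formula `μ_θ(z, y) ≤ w`. -/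
def muLe {m n : ℕ} (θ : L.Formula (Fin m ⊕ Fin (n + 1))) (z : Fin n → α) (y w : α) :
    (plus L).Formula α :=
  ∼ (Relations.formula₂ (ltSym L) (Term.var w)
    (Term.func (muFun θ) fun i => Term.var (Fin.snoc (α := fun _ => α) z y i)))

theorem realize_muLe {m n : ℕ} (θ : L.Formula (Fin m ⊕ Fin (n + 1))) {z : Fin n → α} {y w : α}
    {v : α → G ⊕ J} {c : Fin n → G} {g : G} (hz : v ∘ z = Sum.inl ∘ c) (hy : v y = Sum.inl g) :
    (muLe θ z y w).Realize v ↔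
      ¬ PlusLT L (v w) (Sum.inr (SecondSort.mu θ (Fin.snoc (α := fun _ => G) c g) : J)) := by
  have hv : (fun i => v (Fin.snoc (α := fun _ => α) z y i)) =
      fun i => (Sum.inl (Fin.snoc (α := fun _ => G) c g i) : G ⊕ J) := by
    refine (Fin.comp_snoc v z y).trans ?_
    rw [hz, hy]
    exact (Fin.comp_snoc Sum.inl c g).symm
  rw [muLe, Formula.realize_not, Formula.realize_rel₂]
  simp only [Term.realize_var, Term.realize_func, hv, funMap_muFun]
  rfl

variable (L) in
/-- The `L⁺`-formula `∀ k ∈ I, (k < w₁ ∨ w₀ < k) ∧ ¬ (k < w₀ ∧ w₁ < k)`, which holds for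
`w₀ < w₁` in a linear order. -/
def cutFormula : (plus L).Formula (Fin 2) :=
  let lt (s t : Fin 2 ⊕ Unit) := Relations.formula₂ (ltSym L) (Term.var s) (Term.var t)
  let k : Fin 2 ⊕ Unit := Sum.inr ()
  Formula.iAlls Unit (isHome (Term.var (Sum.inl k)) ⊔
    ((lt k (Sum.inl 1) ⊔ lt (Sum.inl 0) k) ⊓ ∼ (lt k (Sum.inl 0) ⊓ lt (Sum.inl 1) k)))

theorem realize_cutFormula (v : Fin 2 → G ⊕ J) :
    (cutFormula L).Realize v ↔ ∀ k : J,
      (PlusLT L (Sum.inr k) (v 1) ∨ PlusLT L (v 0) (Sum.inr k)) ∧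
        ¬ (PlusLT L (Sum.inr k) (v 0) ∧ PlusLT L (v 1) (Sum.inr k)) := by
  rw [cutFormula, Formula.realize_iAlls]
  simp only [Formula.realize_sup, Formula.realize_inf, Formula.realize_not, Formula.realize_rel₂,
    Term.realize_var, Sum.elim_inl, Sum.elim_inr]
  simp only [Formula.Realize, realize_isHome, Term.realize_var, Sum.elim_inl, Sum.elim_inr]
  constructor
  · intro h k
    simpa [PlusLT] using h fun _ => Sum.inr k
  · intro h i
    rcases i () with g | k
    · exact Or.inl ⟨g, rfl⟩
    · exact Or.inr (h k)

variable {m n : ℕ} {δ ζ : Type*} [Finite δ] [Finite ζ]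

/-- The `L⁺`-formula `∀ z (χ(z) → ∃ x ∀ u (ξ(z, x, u) → ⋀_{i ∈ K} μ_θ(z, uᵢ) ≤ wᵢ →
μ_θ(z, u_q) ≤ w_q))`, in the variables `w` of the second sort. -/
def measureBound (θ : L.Formula (Fin m ⊕ Fin (n + 1))) (χ : L.Formula (Fin n))
    (ξ : L.Formula ((Fin n ⊕ δ) ⊕ ζ)) (K : Set ζ) (q : ζ) : (plus L).Formula ζ :=
  let le (i : ζ) : (plus L).Formula (((ζ ⊕ Fin n) ⊕ δ) ⊕ ζ) :=
    muLe θ (fun j => Sum.inl (Sum.inl (Sum.inr j))) (Sum.inr i) (Sum.inl (Sum.inl (Sum.inl i)))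
  homeAlls (Fin n) ((Formula.relabel Sum.inr (relativize χ)).imp
    (homeExs δ (homeAlls ζ
      ((Formula.relabel (Sum.map (Sum.map Sum.inr id) id) (relativize ξ)).imp
        ((Formula.iInf fun i : K => le i).imp (le q))))))

theorem realize_measureBound (θ : L.Formula (Fin m ⊕ Fin (n + 1))) (χ : L.Formula (Fin n))
    (ξ : L.Formula ((Fin n ⊕ δ) ⊕ ζ)) (K : Set ζ) (q : ζ) (w : ζ → G ⊕ J) :
    (measureBound θ χ ξ K q).Realize w ↔
      ∀ z : Fin n → G, χ.Realize z → ∃ x : δ → G, ∀ u : ζ → G,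
        ξ.Realize (Sum.elim (Sum.elim z x) u) →
        (∀ i ∈ K, ¬ PlusLT L (w i)
          (Sum.inr (SecondSort.mu θ (Fin.snoc (α := fun _ => G) z (u i)) : J))) →
        ¬ PlusLT L (w q) (Sum.inr (SecondSort.mu θ (Fin.snoc (α := fun _ => G) z (u q)) : J)) := by
  have realize_le (z : Fin n → G) (x : δ → G) (u : ζ → G) (i : ζ) :=
    realize_muLe (J := J) θ (z := fun j => Sum.inl (Sum.inl (Sum.inr j))) (y := Sum.inr i)
      (w := Sum.inl (Sum.inl (Sum.inl i)))
      (v := Sum.elim (Sum.elim (Sum.elim w (Sum.inl ∘ z)) (Sum.inl ∘ x)) (Sum.inl ∘ u))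
      (c := z) (g := u i) rfl rfl
  simp only [measureBound, realize_homeAlls, realize_homeExs, Formula.realize_imp,
    Formula.realize_iInf, realize_le, Sum.elim_inl, Subtype.forall]
  refine forall_congr' fun z => imp_congr (realize_relativize_relabel χ rfl) <|
    exists_congr fun x => forall_congr' fun u =>
      imp_congr_left (realize_relativize_relabel ξ ?_)
  funext i
  rcases i with (i | i) | i <;> rfl

end Relativization

section Transfer

variable {L : FirstOrder.Language.{u, v}} {ι : Type*} {U : Ultrafilter ι} {A : ι → Type*}
  [∀ i, L.Structure (A i)] [∀ i, Finite (A i)] {G : Type*} [L.Structure G] {J : Type*}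
  [SecondSort L G J]
  (e : ((U : Filter ι).Product fun i => A i ⊕ unitInterval) ↪ₑ[plus L] (G ⊕ J))

theorem realize_standardPoint {α : Type*} (ψ : (plus L).Formula α) (s : α → unitInterval)
    (h : ∀ i, ψ.Realize fun a => (Sum.inr (s a) : A i ⊕ unitInterval)) :
    ψ.Realize fun a => standardPoint e (s a) :=
  (e.map_formula ψ _).2 ((Ultraproduct.realize_formula_cast ψ
    fun a i => (Sum.inr (s a) : A i ⊕ unitInterval)).2 (Filter.Eventually.of_forall h))

theorem plusLT_finite {A : Type*} [L.Structure A] [Finite A] (s t : unitInterval) :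
    PlusLT L (Sum.inr s : A ⊕ unitInterval) (Sum.inr t) ↔ s < t :=
  plusLT_inr s t

theorem standardPoint_cut (j : J) {s t : unitInterval} (hst : s < t) :
    (PlusLT L (Sum.inr j) (standardPoint e t) ∨ PlusLT L (standardPoint e s) (Sum.inr j)) ∧
      ¬ (PlusLT L (Sum.inr j) (standardPoint e s) ∧ PlusLT L (standardPoint e t) (Sum.inr j)) := by
  have h := realize_standardPoint e (cutFormula L) ![s, t] fun i => by
    rw [realize_cutFormula]
    intro k
    simp only [plusLT_finite]
    exact ⟨(lt_or_ge k t).imp_right hst.trans_le, fun h => lt_asymm hst (h.2.trans h.1)⟩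
  exact (realize_cutFormula _).1 h j

theorem standardPart_nonneg (j : J) : 0 ≤ standardPart e j :=
  Real.sSup_nonneg (by rintro _ ⟨s, -, rfl⟩; exact s.2.1)

theorem standardPart_le_one (j : J) : standardPart e j ≤ 1 :=
  Real.sSup_le (by rintro _ ⟨s, -, rfl⟩; exact s.2.2) zero_le_one

theorem standardPart_le_of_not_plusLT {j : J} {s : unitInterval}
    (h : ¬ PlusLT L (standardPoint e s) (Sum.inr j)) : standardPart e j ≤ s := by
  refine Real.sSup_le ?_ s.2.1
  rintro _ ⟨t, ht, rfl⟩
  by_contra! hst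
  exact (standardPoint_cut e j (show s < t from hst)).1.elim ht h

theorem not_plusLT_of_standardPart_lt {j : J} {t : unitInterval} (h : standardPart e j < t) :
    ¬ PlusLT L (standardPoint e t) (Sum.inr j) := by
  obtain ⟨r, hjr, hrt⟩ := exists_between h
  let s : unitInterval := ⟨r, (standardPart_nonneg e j).trans hjr.le, hrt.le.trans t.2.2⟩
  have hjs : PlusLT L (Sum.inr j) (standardPoint e s) := by
    by_contra hs
    refine hjr.not_ge (le_csSup ⟨1, ?_⟩ ⟨s, hs, rfl⟩)
    rintro _ ⟨t, -, rfl⟩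
    exact t.2.2
  exact fun ht => (standardPoint_cut e j (show s < t from hrt)).2 ⟨hjs, ht⟩

/-- Strict bounds on the standard parts in the hypothesis give bounds on the `μ_θ` themselves, so
that the `L⁺`-sentence true in the `A i` applies. -/
theorem exists_measure_le_of_finite {m n : ℕ} {δ ζ : Type*} [Finite δ] [Finite ζ]
    {θ : L.Formula (Fin m ⊕ Fin (n + 1))} {χ : L.Formula (Fin n)}
    {ξ : L.Formula ((Fin n ⊕ δ) ⊕ ζ)} {K : Set ζ} {q : ζ} (s : ζ → unitInterval)
    (hfin : ∀ i (z : Fin n → A i), χ.Realize z → ∃ x : δ → A i, ∀ u : ζ → A i,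
      ξ.Realize (Sum.elim (Sum.elim z x) u) →
      (∀ k ∈ K, (finiteSecondSort L (A i)).mu θ (Fin.snoc (α := fun _ => A i) z (u k)) ≤ s k) →
      (finiteSecondSort L (A i)).mu θ (Fin.snoc (α := fun _ => A i) z (u q)) ≤ s q)
    {c : Fin n → G} (hc : χ.Realize c) :
    ∃ x : δ → G, ∀ u : ζ → G, ξ.Realize (Sum.elim (Sum.elim c x) u) →
      (∀ k ∈ K, measure e θ (Fin.snoc (α := fun _ => G) c (u k)) < s k) →
      measure e θ (Fin.snoc (α := fun _ => G) c (u q)) ≤ s q := by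
  have h := realize_standardPoint e (measureBound θ χ ξ K q) s fun i => by
    simpa only [realize_measureBound, plusLT_finite, not_lt] using hfin i
  obtain ⟨x, hx⟩ := (realize_measureBound θ χ ξ K q _).1 h c hc
  exact ⟨x, fun u hu hlt => standardPart_le_of_not_plusLT e <|
    hx u hu fun k hk => not_plusLT_of_standardPart_lt e (hlt k hk)⟩

end Transfer

section InstanceFormulas

variable {L : FirstOrder.Language.{u, v}} {G : Type*} [L.Structure G] {n : ℕ} {γ : Type*}

/-- The formula `δ(x; z, y)` in given variables. -/
def instanceFormula (δ : L.Formula (Fin 1 ⊕ Fin (n + 1))) (x : γ) (z : Fin n → γ) (y : γ) :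
    L.Formula γ :=
  δ.relabel (Sum.elim (fun _ => x) (Fin.snoc (α := fun _ => γ) z y))

theorem realize_instanceFormula (δ : L.Formula (Fin 1 ⊕ Fin (n + 1))) (x : γ) (z : Fin n → γ)
    (y : γ) (v : γ → G) :
    (instanceFormula δ x z y).Realize v ↔ binaryRel δ (v ∘ z) (v x) (v y) := by
  rw [instanceFormula, Formula.realize_relabel, Sum.comp_elim]
  exact iff_of_eq (congrArg (fun w => δ.Realize (Sum.elim _ w)) (Fin.comp_snoc v z y))

/-- The formula expressing that `δ(x; z, y)` is `k`-NIP. -/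
def nipFormula (δ : L.Formula (Fin 1 ⊕ Fin (n + 1))) (k : ℕ) : L.Formula (Fin n) :=
  open Classical in
  let ψ (p : Fin k × Set (Fin k)) : L.Formula (Fin n ⊕ (Fin k ⊕ Set (Fin k))) :=
    instanceFormula δ (Sum.inr (Sum.inl p.1)) Sum.inl (Sum.inr (Sum.inr p.2))
  ∼ (Formula.iExs (Fin k ⊕ Set (Fin k))
    (Formula.iInf fun p : Fin k × Set (Fin k) => if p.1 ∈ p.2 then ψ p else ∼ (ψ p)))

theorem realize_nipFormula (δ : L.Formula (Fin 1 ⊕ Fin (n + 1))) (k : ℕ) (c : Fin n → G) :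
    (nipFormula δ k).Realize c ↔ IsNIPWith (binaryRel δ c) k := by
  rw [nipFormula, Formula.realize_not, Formula.realize_iExs, IsNIPWith,
    (Equiv.sumArrowEquivProdArrow _ _ _).exists_congr_left, Prod.exists]
  refine not_congr (exists_congr fun a => exists_congr fun b => ?_)
  rw [Formula.realize_iInf, Prod.forall]
  refine forall_congr' fun i => forall_congr' fun X => ?_
  split_ifs with h <;> simp [h, realize_instanceFormula]

/-- The formula `⋀_j (δ(x_j; z, u₀) ↔ δ(x_j; z, u₁))`. -/
def sameTraceFormula (δ : L.Formula (Fin 1 ⊕ Fin (n + 1))) (N : ℕ) :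
    L.Formula ((Fin n ⊕ Fin N) ⊕ Fin 3) :=
  let ψ (j : Fin N) (i : Fin 3) : L.Formula ((Fin n ⊕ Fin N) ⊕ Fin 3) :=
    instanceFormula δ (Sum.inl (Sum.inr j)) (fun k => Sum.inl (Sum.inl k)) (Sum.inr i)
  Formula.iInf fun j : Fin N => (ψ j 0).iff (ψ j 1)

theorem realize_sameTraceFormula (δ : L.Formula (Fin 1 ⊕ Fin (n + 1))) {N : ℕ} (c : Fin n → G)
    (x : Fin N → G) (u : Fin 3 → G) :
    (sameTraceFormula δ N).Realize (Sum.elim (Sum.elim c x) u) ↔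
      ∀ j, binaryRel δ c (x j) (u 0) ↔ binaryRel δ c (x j) (u 1) := by
  simp only [sameTraceFormula, Formula.realize_iInf, Formula.realize_iff, realize_instanceFormula]
  rfl

variable [GroupLanguage L] [Group G] [CompatibleGroup L G]

variable (L) in
/-- The formula `x / y = z` in given variables. -/
def divFormula (x y z : γ) : L.Formula γ :=
  Term.equal (Term.var x) ((GroupLanguage.mulSym : L.Functions 2).apply₂ (Term.var z) (Term.var y))

theorem realize_divFormula (x y z : γ) (v : γ → G) :
    (divFormula L x y z).Realize v ↔ v x / v y = v z := by
  simp [divFormula, Formula.realize_equal, CompatibleGroup.funMap_mul, div_eq_iff_eq_mul]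

theorem binaryRel_formulaLeft (φ : L.Formula (Fin 1 ⊕ Fin n)) (c : Fin n → G) (x y : G) :
    binaryRel (formulaLeft φ) c x y ↔ φ.Realize (Sum.elim (fun _ => y * x) c) := by
  rw [binaryRel, formulaLeft, Formula.Realize, BoundedFormula.realize_subst]
  refine iff_of_eq (congrArg (fun w => φ.Realize w) (funext ?_))
  rintro (i | i)
  · simp [CompatibleGroup.funMap_mul]
  · simp

theorem binaryRel_formulaRight (φ : L.Formula (Fin 1 ⊕ Fin n)) (c : Fin n → G) (x y : G) :
    binaryRel (formulaRight φ) c x y ↔ φ.Realize (Sum.elim (fun _ => x * y) c) := by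
  rw [binaryRel, formulaRight, Formula.Realize, BoundedFormula.realize_subst]
  refine iff_of_eq (congrArg (fun w => φ.Realize w) (funext ?_))
  rintro (i | i)
  · simp [CompatibleGroup.funMap_mul]
  · simp

theorem setOf_binaryRel_translateDiff (φ : L.Formula (Fin 1 ⊕ Fin n)) (c : Fin n → G) (g : G) :
    {x | binaryRel (translateDiff φ) c x g} =
      symmDiff {x | binaryRel (formulaLeft φ) c x g} {x | binaryRel (formulaLeft φ) c x 1} := by
  ext x
  have h : (φ.relabel (Sum.map id Fin.castSucc)).Realize
      (Sum.elim (fun _ => x) (Fin.snoc (α := fun _ => G) c g)) ↔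
      binaryRel (formulaLeft φ) c x 1 := by
    rw [Formula.realize_relabel, binaryRel_formulaLeft, one_mul, Sum.elim_comp_map]
    refine iff_of_eq (congrArg (fun w => φ.Realize (Sum.elim _ w)) (funext fun i => ?_))
    simp
  simp only [Set.mem_ofPred_eq, Set.mem_symmDiff, ← h]
  simp only [binaryRel, translateDiff, symmDiffFormula, Formula.realize_sup, Formula.realize_inf,
    Formula.realize_not]

end InstanceFormulas

section FiniteGroups

theorem countingMeasure_preimage_equiv {X Y : Type*} [Finite X] [Finite Y] (f : X ≃ Y)
    (S : Set Y) : countingMeasure (f ⁻¹' S) = countingMeasure S := by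
  refine Subtype.ext ?_
  change ((f ⁻¹' S).ncard : ℝ) / Nat.card X = S.ncard / Nat.card Y
  rw [Nat.card_congr f, Set.ncard_preimage_of_injective_subset_range f.injective (by simp)]

theorem countingMeasure_symmDiff_le {X : Type*} [Finite X] (S T W : Set X) :
    (countingMeasure (symmDiff S W) : ℝ) ≤
      countingMeasure (symmDiff S T) + countingMeasure (symmDiff T W) := by
  have h : (symmDiff S W).ncard ≤ (symmDiff S T).ncard + (symmDiff T W).ncard :=
    (Set.ncard_le_ncard (symmDiff_triangle S T W)).trans (Set.ncard_union_le _ _)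
  rw [countingMeasure, countingMeasure, countingMeasure, ← add_div]
  exact div_le_div_of_nonneg_right (by exact_mod_cast h) (Nat.cast_nonneg _)

variable {L : FirstOrder.Language.{u, v}} [GroupLanguage L] {A : Type*} [L.Structure A] [Group A]
  [CompatibleGroup L A] [Finite A] {n : ℕ} (φ : L.Formula (Fin 1 ⊕ Fin n)) (c : Fin n → A)

theorem mu_translateDiff_div (g h : A) :
    (finiteSecondSort L A).mu (translateDiff φ) (Fin.snoc (α := fun _ => A) c (g / h)) =
      countingMeasure (symmDiff {x | binaryRel (formulaLeft φ) c x g}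
        {x | binaryRel (formulaLeft φ) c x h}) := by
  calc _ = countingMeasure (Equiv.funUnique (Fin 1) A ⁻¹'
        {x | binaryRel (translateDiff φ) c x (g / h)}) := by
        refine congrArg countingMeasure (Set.ext fun a => ?_)
        rw [Set.mem_preimage, Set.mem_ofPred_eq, Set.mem_ofPred_eq, binaryRel]
        exact iff_of_eq (congrArg (fun w => Formula.Realize _ (Sum.elim w _))
          (funext fun i => congrArg a (Subsingleton.elim i _)))
    _ = countingMeasure (Equiv.mulLeft h ⁻¹' {x | binaryRel (translateDiff φ) c x (g / h)}) := by
        rw [countingMeasure_preimage_equiv, countingMeasure_preimage_equiv]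
    _ = _ := by
        rw [setOf_binaryRel_translateDiff]
        refine congrArg countingMeasure (Set.ext fun x => ?_)
        simp [Set.mem_symmDiff, binaryRel_formulaLeft, ← mul_assoc]

theorem mu_translateDiff_one :
    (finiteSecondSort L A).mu (translateDiff φ) (Fin.snoc (α := fun _ => A) c 1) = 0 := by
  rw [← div_self' (1 : A), mu_translateDiff_div, symmDiff_self]
  simp [countingMeasure]

theorem mu_translateDiff_div_le (g h : A) :
    ((finiteSecondSort L A).mu (translateDiff φ) (Fin.snoc (α := fun _ => A) c (g / h)) : ℝ) ≤
      (finiteSecondSort L A).mu (translateDiff φ) (Fin.snoc (α := fun _ => A) c g) +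
        (finiteSecondSort L A).mu (translateDiff φ) (Fin.snoc (α := fun _ => A) c h) := by
  have hg := mu_translateDiff_div φ c g 1
  have hh := mu_translateDiff_div φ c h 1
  rw [div_one] at hg hh
  rw [mu_translateDiff_div, hg, hh, symmDiff_comm {x | binaryRel (formulaLeft φ) c x h}]
  exact countingMeasure_symmDiff_le _ _ _

end FiniteGroups

section Stabilizer

variable {L : FirstOrder.Language.{u, v}} [GroupLanguage L] {ι : Type*} {U : Ultrafilter ι}
  {A : ι → Type*} [∀ i, L.Structure (A i)] [∀ i, Group (A i)] [∀ i, CompatibleGroup L (A i)]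
  [∀ i, Finite (A i)]
  {G : Type*} [L.Structure G] [Group G] [CompatibleGroup L G] {J : Type*} [SecondSort L G J]
  (e : ((U : Filter ι).Product fun i => A i ⊕ unitInterval) ↪ₑ[plus L] (G ⊕ J))
  {n : ℕ} (φ : L.Formula (Fin 1 ⊕ Fin n)) (c : Fin n → G)

theorem measure_translateDiff_one :
    measure e (translateDiff φ) (Fin.snoc (α := fun _ => G) c 1) = 0 := by
  obtain ⟨x, hx⟩ := exists_measure_le_of_finite e (θ := translateDiff φ) (χ := ⊤) (δ := Empty)
    (ξ := divFormula L (Sum.inr ()) (Sum.inr ()) (Sum.inr ())) (K := ∅) (q := ()) (fun _ => 0)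
    (fun i z _ => ⟨Empty.elim, fun u hu _ => by
      have hu : 1 = u () := by simpa [realize_divFormula] using hu
      exact (hu ▸ mu_translateDiff_one φ z).le⟩) (c := c) (Formula.realize_top.2 trivial)
  refine le_antisymm (hx (fun _ => 1) ?_ (by simp)) (standardPart_nonneg e _)
  simp [realize_divFormula]

theorem measure_translateDiff_div_le (g h : G) :
    measure e (translateDiff φ) (Fin.snoc (α := fun _ => G) c (g / h)) ≤
      measure e (translateDiff φ) (Fin.snoc (α := fun _ => G) c g) +
        measure e (translateDiff φ) (Fin.snoc (α := fun _ => G) c h) := by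
  set ν : G → ℝ := fun x => measure e (translateDiff φ) (Fin.snoc (α := fun _ => G) c x)
  have ν_nonneg (x : G) : 0 ≤ ν x := standardPart_nonneg e _
  have ν_le_one (x : G) : ν x ≤ 1 := standardPart_le_one e _
  by_contra! hlt
  change ν g + ν h < ν (g / h) at hlt
  obtain ⟨a, hga, ha⟩ := exists_between (lt_sub_iff_add_lt.2 hlt)
  obtain ⟨b, hhb, hb⟩ := exists_between (lt_sub_comm.1 ha)
  rw [lt_sub_iff_add_lt'] at hb
  have hab : a + b ∈ unitInterval :=
    ⟨by linarith [ν_nonneg g, ν_nonneg h], by linarith [ν_le_one (g / h)]⟩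
  let s : Fin 3 → unitInterval := ![⟨a, by linarith [ν_nonneg g], by linarith [ν_nonneg h, hab.2]⟩,
    ⟨b, by linarith [ν_nonneg h], by linarith [ν_nonneg g, hab.2]⟩, ⟨a + b, hab⟩]
  obtain ⟨x, hx⟩ := exists_measure_le_of_finite e (θ := translateDiff φ) (χ := ⊤) (δ := Empty)
    (ξ := divFormula L (Sum.inr 0) (Sum.inr 1) (Sum.inr 2)) (K := {0, 1}) (q := 2) s
    (fun i z _ => ⟨Empty.elim, fun u hu hle => by
      have hu : u 0 / u 1 = u 2 := by simpa only [realize_divFormula, Sum.elim_inr] using hu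
      rw [← hu]
      exact (mu_translateDiff_div_le φ z _ _).trans
        (add_le_add (hle 0 (by simp)) (hle 1 (by simp)))⟩) (c := c) (Formula.realize_top.2 trivial)
  refine hb.not_ge (hx ![g, h, g / h] ?_ ?_)
  · exact (realize_divFormula _ _ _ _).2 rfl
  · rintro k (rfl | rfl)
    exacts [hga, hhb]

/-- The seminorm `g ↦ μ(φ(g x) △ φ(x))`, whose balls are the sets `Stab^ε_μ(φ)`. -/
def stabSeminorm : GroupSeminorm G :=
  seminormOfDiv (fun g => measure e (translateDiff φ) (Fin.snoc (α := fun _ => G) c g))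
    (measure_translateDiff_one e φ c) (measure_translateDiff_div_le e φ c)

theorem stab_eq_setOf_stabSeminorm_le (ε : ℝ) :
    stab e φ c ε = {g | stabSeminorm e φ c g ≤ ε} := by
  ext g
  rw [Set.mem_ofPred_eq, ← map_inv_eq_map]
  rfl

theorem finitelySeparated_stabSeminorm (hNIP : IsNIP (binaryRel (formulaLeft φ) c)) :
    FinitelySeparated (stabSeminorm e φ c) (binaryRel (formulaRight φ) c) := by
  intro η hη
  obtain ⟨k, -, hk⟩ := hNIP
  let η' : unitInterval := ⟨min η 1, (lt_min hη one_pos).le, min_le_right _ _⟩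
  obtain ⟨N, hN⟩ := exists_separating_tuple k (lt_min hη one_pos : (0 : ℝ) < η')
  obtain ⟨x, hx⟩ := exists_measure_le_of_finite e (θ := translateDiff φ)
    (χ := nipFormula (formulaLeft φ) k) (δ := Fin N)
    (ξ := divFormula L (Sum.inr 0) (Sum.inr 1) (Sum.inr 2) ⊓ sameTraceFormula (formulaLeft φ) N)
    (K := ∅) (q := 2) (fun _ => η')
    (fun i z hz => by
      obtain ⟨x, hx⟩ := hN _ _ _ ((realize_nipFormula _ k z).1 hz)
      refine ⟨x, fun u hu _ => ?_⟩
      obtain ⟨hdiv, htr⟩ := Formula.realize_inf.1 hu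
      have hdiv : u 0 / u 1 = u 2 := by simpa only [realize_divFormula, Sum.elim_inr] using hdiv
      rw [← hdiv, mu_translateDiff_div]
      exact hx _ _ ((realize_sameTraceFormula _ _ _ _).1 htr)) ((realize_nipFormula _ k c).2 hk)
  refine ⟨Set.range x, Set.finite_range x, fun g h htp => ?_⟩
  refine (hx ![g, h, g / h] (Formula.realize_inf.2 ⟨?_, ?_⟩) (by simp)).trans (min_le_left _ _)
  · exact (realize_divFormula _ _ _ _).2 rfl
  · refine (realize_sameTraceFormula _ _ _ _).2 fun j => ?_
    have hj := Set.ext_iff.1 htp ⟨x j, Set.mem_range_self j⟩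
    simp only [typeOver, Set.mem_ofPred_eq, binaryRel_formulaRight] at hj
    rwa [binaryRel_formulaLeft, binaryRel_formulaLeft]

end Stabilizer

end PseudofiniteGroup

end

theorem proposition3p2 {L : FirstOrder.Language.{u, v}} [PseudofiniteGroup.GroupLanguage L]
    {ι : Type*} (U : Ultrafilter ι) (A : ι → Type*)
    [∀ i, L.Structure (A i)] [∀ i, Group (A i)] [∀ i, PseudofiniteGroup.CompatibleGroup L (A i)]
    [∀ i, Finite (A i)]
    {G : Type*} [L.Structure G] [Group G] [PseudofiniteGroup.CompatibleGroup L G]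
    {J : Type*} [PseudofiniteGroup.SecondSort L G J]
    (e : ((U : Filter ι).Product fun i => A i ⊕ unitInterval)
      ↪ₑ[PseudofiniteGroup.plus L] (G ⊕ J))
    {n : ℕ} (φ : L.Formula (Fin 1 ⊕ Fin n)) (c : Fin n → G)
    (hNIP : PseudofiniteGroup.IsNIP
      (PseudofiniteGroup.binaryRel (PseudofiniteGroup.formulaLeft φ) c)) :
    (∀ ε : ℝ, 0 < ε →
      PseudofiniteGroup.LeftGeneric (PseudofiniteGroup.stab e φ c ε) ∧
      ∃ B : Set G, B.Countable ∧ PseudofiniteGroup.TypeDefinableBy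
        (PseudofiniteGroup.binaryRel (PseudofiniteGroup.formulaRight φ) c) B
        (PseudofiniteGroup.stab e φ c ε)) ∧
    ∃ H : Subgroup G, (H : Set G) = PseudofiniteGroup.stab e φ c 0 ∧
      #(G ⧸ H) ≤ 𝔠 ∧
      ∃ B : Set G, B.Countable ∧ PseudofiniteGroup.TypeDefinableBy
        (PseudofiniteGroup.binaryRel (PseudofiniteGroup.formulaRight φ) c) B (H : Set G) := by
  open PseudofiniteGroup in
  have hsep := finitelySeparated_stabSeminorm e φ c hNIP
  simp only [stab_eq_setOf_stabSeminorm_le]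
  refine ⟨fun ε hε => ⟨hsep.leftGeneric hε, hsep.exists_typeDefinableBy ε⟩,
    zeroSubgroup (stabSeminorm e φ c), coe_zeroSubgroup _, hsep.mk_quotient_le_continuum, ?_⟩
  rw [coe_zeroSubgroup]
  exact hsep.exists_typeDefinableBy 0
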